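/- **Setting.** A *pretopos* is a small category that is finitary extensive and Barr-exact (finite limits, disjoint and universal finite coproducts, pullback-stable regular epimorphisms, coequalisers of kernel pairs, effective equivalence relations). A *coherent functor* between pretopoi (or from a pretopos to $\mathbf{Set}$) is one preserving finite limits, finite coproducts and regular epimorphisms. A *model* of a pretopos $\mathcal C$ is a coherent functor $\mathcal C\to\mathbf{Set}$; $\mathbf{Mod}(\mathcal C)$ is the category of models and natural transformations. $\mathcal C$ is *categorical* if it has a *canonical model*, i.e. a model $\star$ such that every model is a retract of $\star$. $\mathbf{PT}_c$ is the 2-category of categorical pretopoi, coherent functors and natural transformations. $\mathbf{ProMon}$ is the 2-category of profinite monoids (topological monoids whose underlying space is compact, Hausdorff and totally disconnected); its 1-cells are the continuous semigroup morphisms (preserving multiplication, not necessarily the unit), and its 2-cells $f\to g$, for $f,g:\mathcal M\to\mathcal N$, are the *conjugates*, i.e. the elements $a\in\mathcal N$ with $a f(1)=a=g(1)a$ and $a f(x)=g(x)a$ for all $x\in\mathcal M$; conjugates are composed by multiplication, and the identity of $f$ is $f(1)$. 2-functors are understood up to coherent isomorphism (pseudofunctors), and $(-)^{\mathrm{op}}$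 reverses 1-cells only. **Theorem.** Choose a canonical model $\star_{\mathcal C}$ for every categorical pretopos $\mathcal C$. 1. For every $\mathcal C$, the endomorphism monoid $\mathcal M_{\mathcal C}=\mathbf{Mod}(\mathcal C)(\star_{\mathcal C},\star_{\mathcal C})$, with the subspace topology from the product $\prod_{\varphi\in\mathcal C}\mathbf{Set}(\star_{\mathcal C}\varphi,\star_{\mathcal C}\varphi)$ of discrete spaces, is a profinite monoid. 2. For every choice, for each coherent functor $\theta:\mathcal D\to\mathcal C$ between categorical pretopoi, of natural transformations $r_\theta:\star_{\mathcal D}\to\star_{\mathcal C}\theta$ and $s_\theta:\star_{\mathcal C}\theta\to\star_{\mathcal D}$ with $r_\theta s_\theta=\mathrm{id}$, the assignment $\mathcal C\mapsto\mathcal M_{\mathcal C}$ extends to a 2-functor $$\mathbf{PT}_c^{\mathrm{op}}\to\mathbf{ProMon}$$ which sends a coherent functor $\theta:\mathcal D\to\mathcal C$ to the continuous semigroup morphism $\theta^*:\mathcal M_{\mathcal C}\to\mathcal M_{\mathcal D}$, $\theta^*(f)=s_\theta\circ(f\theta)\circ r_\theta$, and a natural transformation $\alpha:\theta\to\theta'$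 to the conjugate $s_{\theta'}\circ(\star_{\mathcal C}\alpha)\circ r_\theta:\theta^*\to\theta'^*$. -/

import Mathlib

open CategoryTheory CategoryTheory.Limits Opposite

universe u v₁ v₂ v₃ u₁ u₂ u₃

namespace PretoposDuality

/-! ### Pretopoi and coherent functors -/

/-- A pretopos: a finitary extensive category which is Barr-exact, i.e. regular (this includes
the existence of all finite limits) and such that every internal equivalence relation is
effective. -/
class IsPretopos (C : Type u₁) [Category.{v₁} C] : Prop where
  finitaryExtensive : FinitaryExtensive C
  regular : Regular C
  effective : ∀ {R X : C} (p₁ p₂ : R ⟶ X), IsEquivalenceRelation p₁ p₂ →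
    IsEffectiveEquivalenceRelation p₁ p₂

/-- Coherent functors between pretopoi (the category of sets included): functors preserving
finite limits, finite coproducts and regular epimorphisms. Between pretopoi this is the same as
preserving finite limits, images and finite unions of subobjects. -/
structure IsCoherent {C : Type u₁} [Category.{v₁} C] {D : Type u₂} [Category.{v₂} D]
    (F : C ⥤ D) : Prop where
  preservesFiniteLimits : PreservesFiniteLimits F
  preservesFiniteCoproducts : PreservesFiniteCoproducts F
  map_regularEpi : ∀ {X Y : C} (f : X ⟶ Y), IsRegularEpi f → IsRegularEpi (F.map f)

theorem IsCoherent.id (C : Type u₁) [Category.{v₁} C] : IsCoherent (𝟭 C) where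
  preservesFiniteLimits := inferInstance
  preservesFiniteCoproducts := inferInstance
  map_regularEpi _ h := h

theorem IsCoherent.comp {C : Type u₁} [Category.{v₁} C] {D : Type u₂} [Category.{v₂} D]
    {E : Type u₃} [Category.{v₃} E] {F : C ⥤ D} {G : D ⥤ E}
    (hF : IsCoherent F) (hG : IsCoherent G) : IsCoherent (F ⋙ G) where
  preservesFiniteLimits :=
    have := hF.preservesFiniteLimits
    have := hG.preservesFiniteLimits
    comp_preservesFiniteLimits F G
  preservesFiniteCoproducts :=
    have := hF.preservesFiniteCoproducts
    have := hG.preservesFiniteCoproducts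
    inferInstance
  map_regularEpi f h := hG.map_regularEpi _ (hF.map_regularEpi f h)

/-- The type of coherent functors. -/
structure CoherentFunctor (C : Type u₁) [Category.{v₁} C] (D : Type u₂) [Category.{v₂} D] where
  toFunctor : C ⥤ D
  isCoherent : IsCoherent toFunctor

namespace CoherentFunctor

/-- Morphisms of coherent functors are arbitrary natural transformations. -/
instance category (C : Type u₁) [Category.{v₁} C] (D : Type u₂) [Category.{v₂} D] :
    Category (CoherentFunctor C D) where
  Hom F G := F.toFunctor ⟶ G.toFunctor
  id F := 𝟙 F.toFunctor
  comp α β := NatTrans.vcomp α β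

/-- The identity coherent functor. -/
def id (C : Type u₁) [Category.{v₁} C] : CoherentFunctor C C := ⟨𝟭 C, IsCoherent.id C⟩

/-- Composition of coherent functors, in diagrammatic order. -/
def comp {C : Type u₁} [Category.{v₁} C] {D : Type u₂} [Category.{v₂} D]
    {E : Type u₃} [Category.{v₃} E] (F : CoherentFunctor C D) (G : CoherentFunctor D E) :
    CoherentFunctor C E :=
  ⟨F.toFunctor ⋙ G.toFunctor, F.isCoherent.comp G.isCoherent⟩

/-- Precomposing a natural transformation with a coherent functor. -/
def whiskerLeft {C : Type u₁} [Category.{v₁} C] {D : Type u₂} [Category.{v₂} D]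
    {E : Type u₃} [Category.{v₃} E] (F : CoherentFunctor C D) {G H : CoherentFunctor D E}
    (α : G ⟶ H) : F.comp G ⟶ F.comp H :=
  Functor.whiskerLeft F.toFunctor (G := G.toFunctor) (H := H.toFunctor) α

/-- Postcomposing a natural transformation with a coherent functor. -/
def whiskerRight {C : Type u₁} [Category.{v₁} C] {D : Type u₂} [Category.{v₂} D]
    {E : Type u₃} [Category.{v₃} E] {F G : CoherentFunctor C D} (α : F ⟶ G)
    (H : CoherentFunctor D E) : F.comp H ⟶ G.comp H :=
  Functor.whiskerRight (G := F.toFunctor) (H := G.toFunctor) α H.toFunctor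

end CoherentFunctor

/-! ### The 2-category of (small) pretopoi -/

/-- A small pretopos. -/
structure Pretopos : Type (u + 1) where
  carrier : Type u
  [category : SmallCategory carrier]
  [isPretopos : IsPretopos carrier]

namespace Pretopos

instance : CoeSort Pretopos.{u} (Type u) := ⟨Pretopos.carrier⟩

attribute [instance] Pretopos.category Pretopos.isPretopos

/-- The 2-category of pretopoi, coherent functors and natural transformations. -/
instance bicategory : Bicategory Pretopos.{u} where
  Hom C D := CoherentFunctor C D
  id C := CoherentFunctor.id C
  comp F G := F.comp G
  homCategory C D := CoherentFunctor.category C D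
  whiskerLeft F _ _ α := F.whiskerLeft α
  whiskerRight α H := CoherentFunctor.whiskerRight α H
  associator F G H :=
    { hom := 𝟙 (F.toFunctor ⋙ G.toFunctor ⋙ H.toFunctor)
      inv := 𝟙 (F.toFunctor ⋙ G.toFunctor ⋙ H.toFunctor)
      hom_inv_id := Category.id_comp (𝟙 (F.toFunctor ⋙ G.toFunctor ⋙ H.toFunctor))
      inv_hom_id := Category.id_comp (𝟙 (F.toFunctor ⋙ G.toFunctor ⋙ H.toFunctor)) }
  leftUnitor F :=
    { hom := 𝟙 F.toFunctor
      inv := 𝟙 F.toFunctor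
      hom_inv_id := Category.id_comp (𝟙 F.toFunctor)
      inv_hom_id := Category.id_comp (𝟙 F.toFunctor) }
  rightUnitor F :=
    { hom := 𝟙 F.toFunctor
      inv := 𝟙 F.toFunctor
      hom_inv_id := Category.id_comp (𝟙 F.toFunctor)
      inv_hom_id := Category.id_comp (𝟙 F.toFunctor) }
  whiskerLeft_id _ _ := rfl
  whiskerLeft_comp _ _ _ _ _ _ := rfl
  id_whiskerLeft {_ _ _ _} α := NatTrans.ext <| funext fun X => by
    change NatTrans.app α X = 𝟙 _ ≫ NatTrans.app α X ≫ 𝟙 _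
    rw [Category.id_comp, Category.comp_id]
  comp_whiskerLeft F G _ _ α := NatTrans.ext <| funext fun X => by
    change NatTrans.app α (G.toFunctor.obj (F.toFunctor.obj X)) =
      𝟙 _ ≫ NatTrans.app α (G.toFunctor.obj (F.toFunctor.obj X)) ≫ 𝟙 _
    rw [Category.id_comp, Category.comp_id]
  id_whiskerRight F G := NatTrans.ext <| funext fun X =>
    G.toFunctor.map_id (F.toFunctor.obj X)
  comp_whiskerRight α β H := NatTrans.ext <| funext fun X =>
    H.toFunctor.map_comp (NatTrans.app α X) (NatTrans.app β X)
  whiskerRight_id α := NatTrans.ext <| funext fun X => by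
    change NatTrans.app α X = 𝟙 _ ≫ NatTrans.app α X ≫ 𝟙 _
    rw [Category.id_comp, Category.comp_id]
  whiskerRight_comp α G H := NatTrans.ext <| funext fun X => by
    change H.toFunctor.map (G.toFunctor.map (NatTrans.app α X)) =
      𝟙 _ ≫ H.toFunctor.map (G.toFunctor.map (NatTrans.app α X)) ≫ 𝟙 _
    rw [Category.id_comp, Category.comp_id]
  whisker_assoc F _ _ α H := NatTrans.ext <| funext fun X => by
    change H.toFunctor.map (NatTrans.app α (F.toFunctor.obj X)) =
      𝟙 _ ≫ H.toFunctor.map (NatTrans.app α (F.toFunctor.obj X)) ≫ 𝟙 _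
    rw [Category.id_comp, Category.comp_id]
  whisker_exchange α β := NatTrans.ext <| funext fun X =>
    (NatTrans.naturality β (NatTrans.app α X)).symm
  pentagon F G H I := NatTrans.ext <| funext fun X => by
    change I.toFunctor.map (𝟙 _) ≫ 𝟙 _ ≫ 𝟙 _ = 𝟙 _ ≫ 𝟙 _
    rw [I.toFunctor.map_id, Category.id_comp]
  triangle F G := NatTrans.ext <| funext fun X => by
    change 𝟙 _ ≫ 𝟙 _ = G.toFunctor.map (𝟙 _)
    rw [G.toFunctor.map_id, Category.id_comp]

end Pretopos

/-! ### Models and categorical pretopoi -/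

/-- The category of models of a pretopos: coherent functors to the category of sets and natural
transformations between them. -/
abbrev Model (C : Type u) [SmallCategory C] := CoherentFunctor C (Type u)

/-- A model `M` is canonical if every model is a retract of `M`. -/
def IsCanonicalModel {C : Type u} [SmallCategory C] (M : Model C) : Prop :=
  ∀ N : Model C, Nonempty (Retract N M)

/-- A categorical pretopos: a small pretopos with a canonical model. -/
structure CatPretopos : Type (u + 1) extends Pretopos.{u} where
  isCategorical : ∃ M : Model carrier, IsCanonicalModel M

/-- The 2-category of categorical pretopoi, as a full sub-2-category of that of all pretopoi. -/
abbrev PTc := Bicategory.InducedBicategory Pretopos.{u} CatPretopos.toPretopos.{u}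

/-- A choice of a canonical model of a pretopos. -/
structure CanonicalModel (C : Type u) [SmallCategory C] where
  model : Model C
  isCanonical : IsCanonicalModel model

/-! ### Profinite monoids -/

/-- A topological monoid is profinite if its multiplication is continuous and its underlying
space is profinite. -/
structure IsProfiniteMonoid (M : Type u) [Monoid M] [TopologicalSpace M] : Prop where
  continuousMul : ContinuousMul M
  compactSpace : CompactSpace M
  t2Space : T2Space M
  totallyDisconnectedSpace : TotallyDisconnectedSpace M

/-- Profinite monoids. -/
structure ProMon : Type (u + 1) where
  carrier : Type u
  [monoid : Monoid carrier]
  [topology : TopologicalSpace carrier]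
  isProfinite : IsProfiniteMonoid carrier

namespace ProMon

instance : CoeSort ProMon.{u} (Type u) := ⟨ProMon.carrier⟩

attribute [instance] ProMon.monoid ProMon.topology

/-- Continuous semigroup morphisms: continuous maps preserving the multiplication, but not
necessarily the unit. -/
structure Hom (M N : ProMon.{u}) extends M →ₙ* N where
  continuous_toFun : Continuous toFun

instance (M N : ProMon.{u}) : FunLike (Hom M N) M N where
  coe f := f.toFun
  coe_injective := by
    rintro ⟨⟨f, _⟩, _⟩ ⟨⟨g, _⟩, _⟩ h
    cases h
    rfl

theorem Hom.map_mul {M N : ProMon.{u}} (f : Hom M N) (x y : M) : f (x * y) = f x * f y :=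
  f.map_mul' x y

/-- A conjugate `a : f ⟶ g` between semigroup morphisms `f g : M → N` is an element `a` of `N`
with `a * f 1 = a = g 1 * a` and `a * f x = g x * a` for all `x`. -/
@[ext]
structure Conjugate {M N : ProMon.{u}} (f g : Hom M N) where
  val : N
  mul_map_one : val * f 1 = val
  map_one_mul : g 1 * val = val
  naturality : ∀ x : M, val * f x = g x * val

theorem Hom.map_one_mul_self {M N : ProMon.{u}} (f : Hom M N) (x : M) : f 1 * f x = f x := by
  rw [← f.map_mul, one_mul]

theorem Hom.map_mul_one_self {M N : ProMon.{u}} (f : Hom M N) (x : M) : f x * f 1 = f x := by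
  rw [← f.map_mul, mul_one]

/-- The category of continuous semigroup morphisms and conjugates; the identity of `f` is `f 1`,
and composition is multiplication. -/
instance homCategory (M N : ProMon.{u}) : Category (Hom M N) where
  Hom f g := Conjugate f g
  id f :=
    { val := f 1
      mul_map_one := f.map_one_mul_self 1
      map_one_mul := f.map_one_mul_self 1
      naturality := fun x => by rw [f.map_one_mul_self, f.map_mul_one_self] }
  comp a b :=
    { val := b.val * a.val
      mul_map_one := by rw [mul_assoc, a.mul_map_one]
      map_one_mul := by rw [← mul_assoc, b.map_one_mul]
      naturality := fun x => by
        rw [mul_assoc, a.naturality, ← mul_assoc, b.naturality, mul_assoc] }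
  id_comp a := Conjugate.ext a.mul_map_one
  comp_id a := Conjugate.ext a.map_one_mul
  assoc a b c := Conjugate.ext (mul_assoc _ _ _).symm

/-- The identity morphism. -/
def Hom.id (M : ProMon.{u}) : Hom M M where
  toFun x := x
  map_mul' _ _ := rfl
  continuous_toFun := continuous_id

/-- Composition of continuous semigroup morphisms, in diagrammatic order. -/
def Hom.comp {M N P : ProMon.{u}} (f : Hom M N) (g : Hom N P) : Hom M P where
  toFun x := g (f x)
  map_mul' x y := by rw [f.map_mul, g.map_mul]
  continuous_toFun := g.continuous_toFun.comp f.continuous_toFun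

/-- The whiskering of a conjugate `a : g ⟶ h` with a morphism `f` to be applied first. -/
def Conjugate.whiskerLeft {M N P : ProMon.{u}} (f : Hom M N) {g h : Hom N P} (a : g ⟶ h) :
    f.comp g ⟶ f.comp h where
  val := a.val * g (f 1)
  mul_map_one := by
    change a.val * g (f 1) * g (f 1) = _
    rw [mul_assoc, ← g.map_mul, f.map_one_mul_self]
  map_one_mul := by
    change h (f 1) * (a.val * g (f 1)) = _
    rw [← mul_assoc, ← a.naturality, mul_assoc, ← g.map_mul, f.map_one_mul_self]
  naturality x := by
    change a.val * g (f 1) * g (f x) = h (f x) * (a.val * g (f 1))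
    rw [mul_assoc, ← g.map_mul, f.map_one_mul_self, ← mul_assoc, ← a.naturality, mul_assoc,
      ← g.map_mul, f.map_mul_one_self]

/-- The whiskering of a conjugate `a : f ⟶ g` with a morphism `h` to be applied afterwards. -/
def Conjugate.whiskerRight {M N P : ProMon.{u}} {f g : Hom M N} (a : f ⟶ g) (h : Hom N P) :
    f.comp h ⟶ g.comp h where
  val := h a.val
  mul_map_one := by
    change h a.val * h (f 1) = h a.val
    rw [← h.map_mul, a.mul_map_one]
  map_one_mul := by
    change h (g 1) * h a.val = h a.val
    rw [← h.map_mul, a.map_one_mul]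
  naturality x := by
    change h a.val * h (f x) = h (g x) * h a.val
    rw [← h.map_mul, a.naturality, h.map_mul]

/-- The 2-category of profinite monoids, continuous semigroup morphisms and conjugates. -/
instance bicategory : Bicategory ProMon.{u} where
  Hom M N := Hom M N
  id M := Hom.id M
  comp f g := f.comp g
  homCategory M N := homCategory M N
  whiskerLeft f _ _ a := Conjugate.whiskerLeft f a
  whiskerRight a h := Conjugate.whiskerRight a h
  associator f g h := Iso.refl (f.comp (g.comp h))
  leftUnitor f := Iso.refl f
  rightUnitor f := Iso.refl f
  whiskerLeft_id f g := Conjugate.ext (g.map_one_mul_self (f 1))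
  whiskerLeft_comp f _ h _ a b := Conjugate.ext <| by
    change b.val * a.val * _ = b.val * h (f 1) * (a.val * _)
    rw [mul_assoc, mul_assoc, ← mul_assoc (h (f 1)), ← a.naturality, mul_assoc, ← Hom.map_mul,
      f.map_one_mul_self]
  id_whiskerLeft {_ _ f g} a := Conjugate.ext <| by
    change a.val * f 1 = g 1 * a.val * f 1
    rw [a.map_one_mul]
  comp_whiskerLeft {_ _ _ _} f g h h' a := Conjugate.ext <| by
    change a.val * h (g (f 1)) = h' (g (f 1)) * (a.val * h (g 1) * h (g (f 1))) * h (g (f 1))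
    rw [mul_assoc a.val, ← h.map_mul, g.map_one_mul_self, ← mul_assoc, ← a.naturality,
      mul_assoc a.val, ← h.map_mul, ← g.map_mul, f.map_one_mul_self, mul_assoc, ← h.map_mul,
      ← g.map_mul, f.map_one_mul_self]
  id_whiskerRight _ _ := rfl
  comp_whiskerRight a b h := Conjugate.ext (h.map_mul b.val a.val)
  whiskerRight_id {_ _ f g} a := Conjugate.ext <| by
    change a.val = g 1 * a.val * f 1
    rw [a.map_one_mul, a.mul_map_one]
  whiskerRight_comp {_ _ _ _ f f'} a g h := Conjugate.ext <| by
    change h (g a.val) = h (g (f' 1)) * h (g a.val) * h (g (f 1))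
    rw [← h.map_mul, ← h.map_mul, ← g.map_mul, ← g.map_mul, a.map_one_mul, a.mul_map_one]
  whisker_assoc {_ _ _ _} f g g' a h := Conjugate.ext <| by
    change h (a.val * g (f 1)) = h (g' (f 1)) * (h a.val * h (g (f 1))) * h (g (f 1))
    rw [← h.map_mul, ← h.map_mul, ← h.map_mul, ← mul_assoc, ← a.naturality, mul_assoc a.val,
      ← g.map_mul, f.map_one_mul_self, mul_assoc a.val, ← g.map_mul, f.map_one_mul_self]
  whisker_exchange {_ _ _ f g h i} a b := Conjugate.ext <| by
    change i a.val * (b.val * h (f 1)) = b.val * h (g 1) * h a.val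
    rw [mul_assoc, ← h.map_mul, a.map_one_mul, b.naturality a.val, b.naturality (f 1),
      ← mul_assoc, ← i.map_mul, a.mul_map_one]
  pentagon f g h i := Conjugate.ext <| by
    have e : i (h (g (f 1))) * i (h (g (f 1))) = i (h (g (f 1))) := by
      rw [← i.map_mul, ← h.map_mul, ← g.map_mul, f.map_one_mul_self]
    have e' : i (h (g 1)) * i (h (g (f 1))) = i (h (g (f 1))) := by
      rw [← i.map_mul, ← h.map_mul, g.map_one_mul_self]
    change i (h (g 1)) * i (h (g (f 1))) * i (h (g (f 1))) * i (h (g (f 1))) =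
      i (h (g (f 1))) * i (h (g (f 1)))
    rw [e', e, e]
  triangle f g := Conjugate.ext <| by
    change g 1 * g (f 1) * g (f 1) = g (f 1)
    rw [g.map_one_mul_self, ← g.map_mul, f.map_one_mul_self]

/-- Transport of elements along an equality of profinite monoids. -/
def cast {M N : ProMon.{u}} (h : M = N) (x : M) : N := h ▸ x

end ProMon

/-! ### The endomorphism monoid of a model -/

/-- The topology on the endomorphism monoid `End M` (with composition as multiplication) of a
model `M` of `C`: the subspace topology from the inclusion of `End M` into the product, over all
objects `φ` of `C`, of the discrete spaces of all maps `M φ → M φ`. -/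
instance endTopology {C : Type u} [SmallCategory C] (M : Model C) : TopologicalSpace (End M) :=
  TopologicalSpace.induced
    (fun (f : End M) (φ : C) => (NatTrans.app f φ : M.toFunctor.obj φ ⟶ M.toFunctor.obj φ))
    (@Pi.topologicalSpace C _ (fun _ => ⊥))

/-- The endomorphism monoid of a model as a profinite monoid, if it is one. -/
def endProMon {C : Type u} [SmallCategory C] (M : Model C) (h : IsProfiniteMonoid (End M)) :
    ProMon.{u} where
  carrier := End M
  isProfinite := h

/-- For a coherent functor `θ : D ⟶ C`, models `M` of `C` and `N` of `D`, and a retraction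
`r : N ⟶ M ∘ θ` with section `s : M ∘ θ ⟶ N`, the map `f ↦ s ∘ (f θ) ∘ r` from the endomorphisms
of `M` to those of `N`. -/
def transportEnd {C D : Type u} [SmallCategory C] [SmallCategory D] {θ : CoherentFunctor D C}
    {M : Model C} {N : Model D} (ρ : Retract (θ.comp M) N) (f : End M) : End N :=
  ρ.r ≫ θ.whiskerLeft (G := M) (H := M) f ≫ ρ.i

/-- For a natural transformation `α : θ ⟶ θ'`, a model `M` of `C` and a model `N` of `D`, a
retraction `r : N ⟶ M ∘ θ` and a section `s' : M ∘ θ' ⟶ N`, the endomorphism `s' ∘ (M α) ∘ r`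
of `N`. -/
def transportConj {C D : Type u} [SmallCategory C] [SmallCategory D] {θ θ' : CoherentFunctor D C}
    {M : Model C} {N : Model D} (ρ : Retract (θ.comp M) N) (ρ' : Retract (θ'.comp M) N)
    (α : θ ⟶ θ') : End N :=
  ρ.r ≫ CoherentFunctor.whiskerRight α M ≫ ρ'.i

end PretoposDuality

open PretoposDuality

namespace PretoposDuality

open Filter

/-! Profiniteness comes down to finiteness: a canonical model `M` takes only finite values. The
ultrapower functor on sets is coherent (the categorical form of Łoś's theorem,
`ultrapower_isCoherent`), so following `M` by it gives another model, which must be a retract of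
`M`. Were `M φ` infinite, a suitable ultrapower of it would be too large to embed into `M φ`
(`exists_ultrapower_not_injective`). Naturality equations then cut `End M` out as a closed subspace
of a product of finite discrete spaces.

For the 2-functor, restriction along `θ` is a functor between categories of models, and `θ*` is
conjugation of that functor by a retraction. Since `r s = id`, conjugation respects composition but
sends the unit to the idempotent `s r`, which is exactly the identity 2-cell of `θ*`. Hence `θ*`
behaves like the object split by that idempotent: two retractions of the same object yield
canonically isomorphic morphisms, which supplies the comparison cells for identities and composites.
Each coherence law becomes an equation of composites in which adjacent pairs `i ≫ r` cancel, so no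
compatibility among the chosen retractions is needed. -/

/-! ### Ultrapowers -/

/-- The ultrapower functor on types. -/
def ultrapower {I : Type u} (U : Ultrafilter I) : Type u ⥤ Type u where
  obj X := Germ (U : Filter I) X
  map f := ↾(Germ.map f)
  map_id X := by
    ext x
    exact congrFun Germ.map_id x
  map_comp f g := by
    ext x
    exact (Germ.map_map g f x).symm

section Ultrapower

variable {I : Type u} (U : Ultrafilter I)

theorem ultrapower_map_coe {X Y : Type u} (f : X ⟶ Y) (x : I → X) :
    (ultrapower U).map f (Germ.ofFun x : Germ (U : Filter I) X) =
      (Germ.ofFun (fun i => f (x i)) : Germ (U : Filter I) Y) :=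
  rfl

/-- A finite diagram imposes finitely many compatibility equations. If each holds on a set of `U`,
all hold together on one, and the limit points can be chosen index by index there. -/
theorem ultrapower_preservesFiniteLimits : PreservesFiniteLimits (ultrapower U) where
  preservesFiniteLimits J _ _ :=
    { preservesLimit := fun {K} => ⟨fun {c} hc => by
        have hc' := (Types.isLimit_iff c).1 ⟨hc⟩
        rw [Types.isLimit_iff]
        intro s hs
        choose g hg using fun j : J => Quotient.exists_rep (s j)
        replace hg : ∀ j, (Germ.ofFun (g j) : Germ (U : Filter I) (K.obj j)) = s j := hg
        have hU : ∀ᶠ i in (U : Filter I), (fun j => g j i) ∈ K.sections := by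
          have : ∀ᶠ i in (U : Filter I), ∀ (j j' : J) (m : j ⟶ j'), K.map m (g j i) = g j' i := by
            simp only [eventually_all]
            intro j j' m
            have h : (ultrapower U).map (K.map m) (s j) = s j' := hs m
            rw [← hg, ← hg, ultrapower_map_coe] at h
            exact Germ.coe_eq.1 h
          exact this.mono fun i hi _ _ m => hi _ _ m
        obtain ⟨i₀, hi₀⟩ := hU.exists
        -- An arbitrary point serves at the indices where the representatives are incompatible;
        -- these form a `U`-null set.
        have : Nonempty c.pt := ⟨(hc' _ hi₀).choose⟩
        have key : ∀ i, ∃ x : c.pt, (fun j => g j i) ∈ K.sections → ∀ j, c.π.app j x = g j i :=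
          fun i => (em ((fun j => g j i) ∈ K.sections)).elim
            (fun h => (hc' _ h).exists.imp fun _ hx _ => hx)
            fun h => ⟨Classical.arbitrary _, fun h' => (h h').elim⟩
        choose x hx using key
        refine ⟨(Germ.ofFun x : Germ (U : Filter I) c.pt), fun j => ?_, fun y => ?_⟩
        · rw [← hg]
          exact Germ.coe_eq.2 (hU.mono fun i hi => hx i hi j)
        · refine Germ.inductionOn y fun y hy => Germ.coe_eq.2 ?_
          have hy' : ∀ᶠ i in (U : Filter I), ∀ j, c.π.app j (y i) = g j i := by
            rw [eventually_all]
            intro j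
            have := hy j
            rw [← hg] at this
            exact Germ.coe_eq.1 this
          filter_upwards [hU, hy'] with i hi hyi
          exact (hc' _ hi).unique hyi (hx i hi)⟩ }

theorem ultrapower_preservesInitial :
    PreservesColimit (Functor.empty.{0} (Type u)) (ultrapower U) := by
  have e : IsEmpty ((ultrapower U).obj PEmpty.{u + 1}) := by
    refine ⟨fun x => Germ.inductionOn x fun f => ?_⟩
    obtain ⟨i, -⟩ := (Eventually.of_forall (f := (U : Filter I)) fun _ => True.intro).exists
    exact (f i).elim
  refine preservesColimit_of_preserves_colimit_cocone Types.isInitialPEmpty ?_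
  exact (isColimitMapCoconeEmptyCoconeEquiv _ _).symm ((Types.initial_iff_empty _).2 e).some

/-- Here the filter must be an ultrafilter: a germ in a sum is either almost everywhere on the left
or almost everywhere on the right. -/
theorem ultrapower_preservesBinaryCoproducts :
    PreservesColimitsOfShape (Discrete WalkingPair) (ultrapower U) where
  preservesColimit {K} := by
    have (X Y : Type u) : PreservesColimit (pair X Y) (ultrapower U) := by
      refine preservesColimit_of_preserves_colimit_cocone (Types.binaryCoproductColimit X Y) ?_
      refine (isColimitMapCoconeBinaryCofanEquiv _ _ _).symm ?_
      refine ((Types.binaryCofan_isColimit_iff _).2 ⟨?_, ?_, ?_⟩).some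
      · intro x y
        refine Germ.inductionOn₂ x y fun x y h => Germ.coe_eq.2 ?_
        exact (Germ.coe_eq.1 h).mono fun i hi => Sum.inl_injective hi
      · intro x y
        refine Germ.inductionOn₂ x y fun x y h => Germ.coe_eq.2 ?_
        exact (Germ.coe_eq.1 h).mono fun i hi => Sum.inr_injective hi
      · constructor
        · rw [Set.disjoint_left]
          rintro _ ⟨x, rfl⟩ ⟨y, hy⟩
          revert hy
          refine Germ.inductionOn₂ x y fun x y h => ?_
          obtain ⟨i, hi⟩ := (Germ.coe_eq.1 h).exists
          exact Sum.inr_ne_inl hi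
        · refine codisjoint_iff.2 (Set.eq_univ_of_forall fun z => ?_)
          refine Germ.inductionOn z fun z => ?_
          rcases U.eventually_or.1 (Eventually.of_forall fun i =>
            (z i).casesOn (fun _ => Or.inl rfl) fun _ => Or.inr rfl :
              ∀ᶠ i in (U : Filter I), (z i).isLeft ∨ (z i).isRight) with h | h
          · left
            have : Nonempty X := by
              obtain ⟨i, hi⟩ := h.exists
              exact ⟨(z i).getLeft hi⟩
            refine ⟨Germ.ofFun fun i => Sum.elim id (fun _ => Classical.arbitrary X) (z i),
              Germ.coe_eq.2 (h.mono fun i hi => ?_)⟩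
            obtain ⟨a, ha⟩ := Sum.isLeft_iff.1 hi
            simp [ha]
          · right
            have : Nonempty Y := by
              obtain ⟨i, hi⟩ := h.exists
              exact ⟨(z i).getRight hi⟩
            refine ⟨Germ.ofFun fun i => Sum.elim (fun _ => Classical.arbitrary Y) id (z i),
              Germ.coe_eq.2 (h.mono fun i hi => ?_)⟩
            obtain ⟨a, ha⟩ := Sum.isRight_iff.1 hi
            simp [ha]
    exact preservesColimit_of_iso_diagram _ (diagramIsoPair K).symm

theorem ultrapower_isCoherent : IsCoherent (ultrapower U) where
  preservesFiniteLimits := ultrapower_preservesFiniteLimits U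
  preservesFiniteCoproducts := by
    have := ultrapower_preservesInitial U
    have := ultrapower_preservesBinaryCoproducts U
    have : PreservesColimitsOfShape (Discrete PEmpty.{1}) (ultrapower U) :=
      preservesColimitsOfShape_pempty_of_preservesInitial _
    exact ⟨fun n => PreservesFiniteCoproducts.of_preserves_binary_and_initial _ _⟩
  map_regularEpi {X Y} f hf := by
    have : Epi f := inferInstance
    have hs := (epi_iff_surjective f).1 this
    have : Epi ((ultrapower U).map f) := (epi_iff_surjective _).2 fun y =>
      Germ.inductionOn y fun y => ⟨Germ.ofFun fun i => (hs (y i)).choose,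
        Germ.coe_eq.2 (Eventually.of_forall fun i => (hs (y i)).choose_spec)⟩
    exact IsRegularEpiCategory.regularEpiOfEpi _

end Ultrapower

/-- Every infinite type `X` has an ultrapower which does not embed into `X`. -/
theorem exists_ultrapower_not_injective (X : Type u) [Infinite X] :
    ∃ (I : Type u) (U : Ultrafilter I),
      ∀ f : (ultrapower U).obj X → X, ¬ Function.Injective f := by
  classical
  -- The aim is to embed the power set of `X` into the ultrapower, against Cantor. Indices are
  -- finite sets `s` of subsets of `X`; refining `atTop` makes almost every `s` contain any given
  -- subsets.
  obtain ⟨U, hU⟩ : ∃ U : Ultrafilter (Finset (Set X)), (U : Filter (Finset (Set X))) ≤ atTop :=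
    ⟨_, Ultrafilter.of_le _⟩
  refine ⟨Finset (Set X), U, fun f hf => ?_⟩
  -- Each finite `s` embeds into the infinite `X`, and `A` is sent to the germ of `s ↦ e s A`.
  -- Distinct subsets differ at every `s` containing both; the default value matters only where `A ∉
  -- s`.
  let e (s : Finset (Set X)) : s ↪ X :=
    (s.equivFin.toEmbedding.trans Fin.valEmbedding).trans (Infinite.natEmbedding X)
  let g (A : Set X) (s : Finset (Set X)) : X :=
    if h : A ∈ s then e s ⟨A, h⟩ else Classical.arbitrary X
  refine Function.cantor_injective
    (fun A => f (Germ.ofFun (g A) : Germ (U : Filter (Finset (Set X))) X))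
    (hf.comp fun A B h => ?_)
  have h₁ : ∀ᶠ s in (U : Filter (Finset (Set X))), A ∈ s ∧ B ∈ s :=
    hU ((eventually_ge_atTop {A, B}).mono fun s hs => by
      simpa [Finset.insert_subset_iff] using hs)
  obtain ⟨s, ⟨hA, hB⟩, hs⟩ := (h₁.and (Germ.coe_eq.1 h)).exists
  simpa [g, hA, hB] using hs

/-- The values of a canonical model are finite. -/
theorem IsCanonicalModel.finite {C : Type u} [SmallCategory C] {M : Model C}
    (hM : IsCanonicalModel M) (φ : C) : Finite (M.toFunctor.obj φ) := by
  by_contra h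
  rw [not_finite_iff_infinite] at h
  obtain ⟨I, U, hU⟩ := exists_ultrapower_not_injective (M.toFunctor.obj φ)
  obtain ⟨ρ⟩ := hM ⟨M.toFunctor ⋙ ultrapower U, M.isCoherent.comp (ultrapower_isCoherent U)⟩
  refine hU (NatTrans.app ρ.i φ) (Function.LeftInverse.injective (g := NatTrans.app ρ.r φ) ?_)
  intro x
  exact ConcreteCategory.congr_hom (congrArg (fun t => NatTrans.app t φ) ρ.retract) x

/-! ### The topology of the endomorphism monoid of a model -/

section EndTopology

variable {C D : Type u} [SmallCategory C] [SmallCategory D]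

theorem continuous_end_iff {X : Type*} [TopologicalSpace X] {M : Model C} {f : X → End M} :
    Continuous f ↔
      ∀ φ, @Continuous X (M.toFunctor.obj φ ⟶ M.toFunctor.obj φ) _ ⊥
        fun x => NatTrans.app (f x) φ := by
  let _ (φ : C) : TopologicalSpace (M.toFunctor.obj φ ⟶ M.toFunctor.obj φ) := ⊥
  exact continuous_induced_rng.trans continuous_pi_iff

theorem continuous_end_app (M : Model C) (φ : C) :
    @Continuous (End M) (M.toFunctor.obj φ ⟶ M.toFunctor.obj φ) _ ⊥
      fun f => NatTrans.app f φ :=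
  continuous_end_iff.1 continuous_id φ

/-- The component at `φ` of the result depends only on the component of the argument at `θ φ`,
through a map of discrete spaces. -/
theorem continuous_transportEnd {θ : CoherentFunctor D C} {M : Model C} {N : Model D}
    (ρ : Retract (θ.comp M) N) : Continuous (transportEnd ρ) := by
  rw [continuous_end_iff]
  intro φ
  let (X : Type u) : TopologicalSpace (X ⟶ X) := ⊥
  have (X : Type u) : DiscreteTopology (X ⟶ X) := ⟨rfl⟩
  exact (continuous_of_discreteTopology (f := fun t : (M.toFunctor.obj (θ.toFunctor.obj φ)) ⟶
    (M.toFunctor.obj (θ.toFunctor.obj φ)) => NatTrans.app ρ.r φ ≫ t ≫ NatTrans.app ρ.i φ)).comp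
      (continuous_end_app M (θ.toFunctor.obj φ))

theorem isProfiniteMonoid_end {M : Model C} (hM : ∀ φ, Finite (M.toFunctor.obj φ)) :
    IsProfiniteMonoid (End M) := by
  let (X : Type u) : TopologicalSpace (X ⟶ X) := ⊥
  have (X : Type u) : DiscreteTopology (X ⟶ X) := ⟨rfl⟩
  have (φ : C) : Finite (M.toFunctor.obj φ ⟶ M.toFunctor.obj φ) :=
    Finite.of_equiv _ TypeCat.homEquiv.symm
  let ι (f : End M) (φ : C) : M.toFunctor.obj φ ⟶ M.toFunctor.obj φ := NatTrans.app f φ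
  have hinj : Function.Injective ι := fun f g h =>
    NatTrans.ext (F := M.toFunctor) (G := M.toFunctor) h
  have hι : Topology.IsClosedEmbedding ι := by
    refine ⟨⟨⟨rfl⟩, hinj⟩, ?_⟩
    -- Each naturality square involves just two coordinates, so it defines the preimage of a subset
    -- of a discrete space.
    have : Set.range ι = ⋂ (φ : C) (ψ : C) (m : φ ⟶ ψ),
        {t | M.toFunctor.map m ≫ t ψ = t φ ≫ M.toFunctor.map m} := by
      ext t
      simp only [Set.mem_iInter, Set.mem_ofPred_eq]
      constructor
      · rintro ⟨f, rfl⟩ φ ψ m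
        exact NatTrans.naturality f m
      · intro h
        exact ⟨(⟨t, fun φ ψ m => h φ ψ m⟩ : M.toFunctor ⟶ M.toFunctor), rfl⟩
    rw [this]
    refine isClosed_iInter fun φ => isClosed_iInter fun ψ => isClosed_iInter fun m => ?_
    have hc : Continuous fun t : (∀ φ, M.toFunctor.obj φ ⟶ M.toFunctor.obj φ) => (t φ, t ψ) :=
      (continuous_apply φ).prodMk (continuous_apply ψ)
    exact (isClosed_discrete {p : (M.toFunctor.obj φ ⟶ M.toFunctor.obj φ) ×
      (M.toFunctor.obj ψ ⟶ M.toFunctor.obj ψ) |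
        M.toFunctor.map m ≫ p.2 = p.1 ≫ M.toFunctor.map m}).preimage hc
  exact
    { continuousMul := ⟨continuous_end_iff.2 fun φ =>
        (continuous_of_discreteTopology (f := fun p : (M.toFunctor.obj φ ⟶ M.toFunctor.obj φ) ×
          (M.toFunctor.obj φ ⟶ M.toFunctor.obj φ) => p.2 ≫ p.1)).comp
            (((continuous_end_app M φ).comp continuous_fst).prodMk
              ((continuous_end_app M φ).comp continuous_snd))⟩
      compactSpace := hι.compactSpace
      t2Space := hι.isEmbedding.t2Space
      totallyDisconnectedSpace :=
        hι.isEmbedding.isTotallyDisconnected_range.1 (isTotallyDisconnected_of_totallyDisconnectedSpace _) }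

end EndTopology

/-! ### Retracts and functors -/

section Retract

variable {𝒞 𝒟 ℰ ℱ : Type*} [Category* 𝒞] [Category* 𝒟] [Category* ℰ] [Category* ℱ]

theorem map_retract_assoc (T : 𝒞 ⥤ 𝒟) {X Y : 𝒞} (ρ : Retract X Y) {Z : 𝒟} (f : T.obj X ⟶ Z) :
    T.map ρ.i ≫ T.map ρ.r ≫ f = f := by
  rw [← T.map_comp_assoc, ρ.retract, T.map_id, Category.id_comp]

/-- The inner `σ.i ≫ σ.r` cancels. This gives multiplicativity of transport, functoriality on
2-cells and invertibility of the comparison cells. -/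
theorem retract_conj_comp {X Y Z N : 𝒞} (ρ : Retract X N) (σ : Retract Y N) (τ : Retract Z N)
    (f : X ⟶ Y) (g : Y ⟶ Z) :
    (ρ.r ≫ f ≫ σ.i) ≫ σ.r ≫ g ≫ τ.i = ρ.r ≫ (f ≫ g) ≫ τ.i := by
  simp

variable {Θ Θ' : 𝒞 ⥤ 𝒟} {T T' : 𝒟 ⥤ ℰ} {U : ℰ ⥤ ℱ} {M : 𝒞} {N : 𝒟} {P : ℰ} {Q : ℱ}

theorem retract_map_trans (ρ : Retract (Θ.obj M) N) (σ : Retract (T.obj N) P)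
    (f : M ⟶ M) :
    σ.r ≫ T.map (ρ.r ≫ Θ.map f ≫ ρ.i) ≫ σ.i =
      ((ρ.map T).trans σ).r ≫ T.map (Θ.map f) ≫ ((ρ.map T).trans σ).i := by
  simp

theorem retract_conj_naturality (ρ : Retract (Θ.obj M) N) (ρ' : Retract (Θ'.obj M) N)
    (α : Θ ⟶ Θ') (f : M ⟶ M) :
    (ρ.r ≫ Θ.map f ≫ ρ.i) ≫ ρ.r ≫ α.app M ≫ ρ'.i =
      (ρ.r ≫ α.app M ≫ ρ'.i) ≫ ρ'.r ≫ Θ'.map f ≫ ρ'.i := by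
  simp

/-- This and the next four lemmas are the pseudofunctor axioms on underlying elements. The
retractions `κ`, `κ'`, `μ`, `μ'` chosen for composites are unrelated to `ρ`, `σ`, `τ`. Factors
containing `Θ.map (𝟙 M)` are values of the transported morphisms at the unit, produced by whiskering
or by identity 2-cells. -/
theorem retract_whiskerLeft (ρ : Retract (Θ.obj M) N) (σ : Retract (T.obj N) P)
    (σ' : Retract (T'.obj N) P) (κ : Retract (T.obj (Θ.obj M)) P)
    (κ' : Retract (T'.obj (Θ.obj M)) P) (α : T ⟶ T') :
    κ.r ≫ α.app (Θ.obj M) ≫ κ'.i =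
      (κ.r ≫ T.map ρ.i ≫ σ.i) ≫
        ((σ.r ≫ T.map (ρ.r ≫ Θ.map (𝟙 M) ≫ ρ.i) ≫ σ.i) ≫ σ.r ≫ α.app N ≫ σ'.i) ≫
          σ'.r ≫ T'.map ρ.r ≫ κ'.i := by
  simp [map_retract_assoc]

theorem retract_whiskerRight (ρ : Retract (Θ.obj M) N) (ρ' : Retract (Θ'.obj M) N)
    (σ : Retract (T.obj N) P) (κ : Retract (T.obj (Θ.obj M)) P)
    (κ' : Retract (T.obj (Θ'.obj M)) P) (α : Θ ⟶ Θ') :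
    κ.r ≫ T.map (α.app M) ≫ κ'.i =
      (κ.r ≫ T.map ρ.i ≫ σ.i) ≫ (σ.r ≫ T.map (ρ.r ≫ α.app M ≫ ρ'.i) ≫ σ.i) ≫
          σ.r ≫ T.map ρ'.r ≫ κ'.i := by
  simp [map_retract_assoc]

theorem retract_associator (ρ : Retract (Θ.obj M) N) (σ : Retract (T.obj N) P)
    (τ : Retract (U.obj P) Q) (κ : Retract (T.obj (Θ.obj M)) P)
    (κ' : Retract (U.obj (T.obj N)) Q) (μ μ' : Retract (U.obj (T.obj (Θ.obj M))) Q) :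
    μ.r ≫ 𝟙 _ ≫ μ'.i =
      (μ.r ≫ U.map κ.i ≫ τ.i) ≫ (τ.r ≫ U.map (κ.r ≫ T.map ρ.i ≫ σ.i) ≫ τ.i) ≫
        (τ.r ≫ U.map (σ.r ≫ T.map (ρ.r ≫ Θ.map (𝟙 M) ≫ ρ.i) ≫ σ.i) ≫ τ.i) ≫
          ((τ.r ≫ U.map (σ.r ≫ T.map (ρ.r ≫ Θ.map (𝟙 M) ≫ ρ.i) ≫ σ.i) ≫ τ.i) ≫
            τ.r ≫ U.map σ.r ≫ κ'.i) ≫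
          κ'.r ≫ U.map (T.map ρ.r) ≫ μ'.i := by
  have h {Z : ℱ} (f : U.obj (T.obj (Θ.obj M)) ⟶ Z) :
      U.map (T.map ρ.i) ≫ U.map (T.map ρ.r) ≫ f = f :=
    map_retract_assoc (T ⋙ U) ρ f
  simp [map_retract_assoc, h]

theorem retract_leftUnitor (ι : Retract M M) (ρ κ : Retract (Θ.obj M) N) :
    κ.r ≫ 𝟙 _ ≫ ρ.i =
      (κ.r ≫ Θ.map ι.i ≫ ρ.i) ≫ (ρ.r ≫ Θ.map ι.r ≫ ρ.i) ≫ ρ.r ≫ Θ.map (𝟙 M) ≫ ρ.i := by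
  simp [map_retract_assoc]

theorem retract_rightUnitor (ι : Retract N N) (ρ κ : Retract (Θ.obj M) N) :
    κ.r ≫ 𝟙 _ ≫ ρ.i =
      (κ.r ≫ ρ.i ≫ ι.i) ≫ ((ι.r ≫ (ρ.r ≫ Θ.map (𝟙 M) ≫ ρ.i) ≫ ι.i) ≫ ι.r) ≫
        ρ.r ≫ Θ.map (𝟙 M) ≫ ρ.i := by
  simp

end Retract

/-! ### Restriction of models -/

section Restriction

variable {C D : Type u} [SmallCategory C] [SmallCategory D]

/-- Restriction of models along a coherent functor. -/
def restriction (θ : CoherentFunctor D C) : Model C ⥤ Model D where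
  obj M := θ.comp M
  map f := θ.whiskerLeft f

/-- The natural transformation between restriction functors induced by a natural transformation
of coherent functors. -/
def restrictionMap {θ θ' : CoherentFunctor D C} (α : θ ⟶ θ') :
    restriction θ ⟶ restriction θ' where
  app M := CoherentFunctor.whiskerRight α M
  naturality _ _ f := NatTrans.ext <| funext fun X =>
    (NatTrans.naturality f (NatTrans.app α X)).symm

theorem restrictionMap_id (θ : CoherentFunctor D C) :
    restrictionMap (𝟙 θ) = 𝟙 (restriction θ) :=
  NatTrans.ext <| funext fun M => NatTrans.ext <| funext fun X =>
    M.toFunctor.map_id (θ.toFunctor.obj X)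

theorem restrictionMap_comp {θ θ' θ'' : CoherentFunctor D C} (α : θ ⟶ θ') (β : θ' ⟶ θ'') :
    restrictionMap (α ≫ β) = restrictionMap α ≫ restrictionMap β :=
  NatTrans.ext <| funext fun M => NatTrans.ext <| funext fun X =>
    M.toFunctor.map_comp (NatTrans.app α X) (NatTrans.app β X)

end Restriction

/-! ### The pseudofunctor -/

/-- A natural transformation `T ⟶ T'` induces a conjugate between the semigroup morphisms
obtained by transport along retractions of `N` onto `T.obj M` and `T'.obj M`. -/
def conjugateOfNatTrans {C D : Type u} [SmallCategory C] [SmallCategory D] {M : Model C}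
    {N : Model D} {hM : IsProfiniteMonoid (End M)} {hN : IsProfiniteMonoid (End N)}
    {T T' : Model C ⥤ Model D} (ρ : Retract (T.obj M) N) (ρ' : Retract (T'.obj M) N)
    {f g : endProMon M hM ⟶ endProMon N hN}
    (hf : ∀ x : End M, f.toFun x = (ρ.r ≫ T.map x ≫ ρ.i : N ⟶ N))
    (hg : ∀ x : End M, g.toFun x = (ρ'.r ≫ T'.map x ≫ ρ'.i : N ⟶ N))
    (α : T ⟶ T') : f ⟶ g :=
  show ProMon.Conjugate f g from
  { val := (ρ.r ≫ α.app M ≫ ρ'.i : N ⟶ N)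
    mul_map_one := by
      refine (congrArg (fun t : N ⟶ N => t ≫ ρ.r ≫ α.app M ≫ ρ'.i) (hf (𝟙 M))).trans ?_
      simp
    map_one_mul := by
      refine (congrArg (fun t : N ⟶ N => (ρ.r ≫ α.app M ≫ ρ'.i) ≫ t) (hg (𝟙 M))).trans ?_
      simp
    naturality := fun x => by
      refine (congrArg (fun t : N ⟶ N => t ≫ ρ.r ≫ α.app M ≫ ρ'.i) (hf x)).trans
        (Eq.trans ?_ (congrArg (fun t : N ⟶ N => (ρ.r ≫ α.app M ≫ ρ'.i) ≫ t) (hg x)).symm)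
      exact retract_conj_naturality ρ ρ' α x }

section EndPseudofunctor

variable (M : ∀ C : PTc.{u}, Model C.toPretopos) (hM : ∀ C, IsProfiniteMonoid (End (M C)))
  (ρ : ∀ {D C : PTc.{u}} (θ : D ⟶ C), Retract (θ.hom.comp (M C)) (M D))

/-- The continuous semigroup morphism `f ↦ s ∘ (f θ) ∘ r` between endomorphism monoids. -/
def endMap {C D : PTc.{u}} (θ : D ⟶ C) : endProMon (M C) (hM C) ⟶ endProMon (M D) (hM D) :=
  show ProMon.Hom _ _ from
  { toFun := transportEnd (ρ θ)
    map_mul' := fun f g =>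
      ((retract_conj_comp (ρ θ) (ρ θ) (ρ θ) ((restriction θ.hom).map g)
        ((restriction θ.hom).map f))).symm
    continuous_toFun := continuous_transportEnd (ρ θ) }

/-- The conjugate induced by a natural transformation between coherent functors. -/
def endMap₂ {C D : PTc.{u}} {θ θ' : D ⟶ C} (α : θ ⟶ θ') :
    endMap M hM ρ θ ⟶ endMap M hM ρ θ' :=
  conjugateOfNatTrans (T := restriction θ.hom) (T' := restriction θ'.hom) (ρ θ) (ρ θ')
    (fun _ => rfl) (fun _ => rfl) (restrictionMap α.hom)

/-- Allows the whiskered transformation to be replaced by an identity or a composite before the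
retract identities apply. -/
theorem endMap₂_val {C D : PTc.{u}} {θ θ' : D ⟶ C} (α : θ ⟶ θ')
    (k : (restriction θ.hom).obj (M C) ⟶ (restriction θ'.hom).obj (M C))
    (hk : CoherentFunctor.whiskerRight α.hom (M C) = k) :
    (endMap₂ M hM ρ α).val = ((ρ θ).r ≫ k ≫ (ρ θ').i : M D ⟶ M D) := by
  subst hk
  rfl

/-- The comparison of `endMap` at an identity functor with the identity. -/
def endMapId (C : PTc.{u}) : endMap M hM ρ (𝟙 C) ≅ 𝟙 (endProMon (M C) (hM C)) where
  -- The identity morphism is transport along the trivial retraction; the one chosen for `𝟙 C` may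
  -- be nontrivial.
  hom := conjugateOfNatTrans (T := 𝟭 _) (T' := 𝟭 _) (ρ (𝟙 C)) (Retract.refl (M C))
    (fun _ => rfl) (fun x => ((Category.id_comp _).trans (Category.comp_id x)).symm) (𝟙 _)
  inv := conjugateOfNatTrans (T := 𝟭 _) (T' := 𝟭 _) (Retract.refl (M C)) (ρ (𝟙 C))
    (fun x => ((Category.id_comp _).trans (Category.comp_id x)).symm) (fun _ => rfl) (𝟙 _)
  hom_inv_id := ProMon.Conjugate.ext <|
    retract_conj_comp (ρ (𝟙 C)) (Retract.refl (M C)) (ρ (𝟙 C)) (𝟙 _) (𝟙 _)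
  inv_hom_id := ProMon.Conjugate.ext <|
    (retract_conj_comp (Retract.refl (M C)) (ρ (𝟙 C)) (Retract.refl (M C)) (𝟙 _) (𝟙 _)).trans
      (by simp; rfl)

/-- The comparison of `endMap` at a composite with the composite. -/
def endMapComp {C D E : PTc.{u}} (τ : E ⟶ D) (θ : D ⟶ C) :
    endMap M hM ρ (τ ≫ θ) ≅ endMap M hM ρ θ ≫ endMap M hM ρ τ :=
  -- Two successive transports form a single transport along the composite retraction `σ`, which
  -- retracts onto the same object as `ρ (τ ≫ θ)`.
  let σ : Retract ((restriction θ.hom ⋙ restriction τ.hom).obj (M C)) (M E) :=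
    (Retract.map (ρ θ) (restriction τ.hom)).trans (ρ τ)
  have hσ (x : End (M C)) : (endMap M hM ρ θ ≫ endMap M hM ρ τ).toFun x =
      (σ.r ≫ (restriction θ.hom ⋙ restriction τ.hom).map x ≫ σ.i : M E ⟶ M E) :=
    retract_map_trans (Θ := restriction θ.hom) (T := restriction τ.hom) (ρ θ) (ρ τ) x
  { hom := conjugateOfNatTrans (T := restriction θ.hom ⋙ restriction τ.hom)
      (T' := restriction θ.hom ⋙ restriction τ.hom) (ρ (τ ≫ θ)) σ (fun _ => rfl) hσ (𝟙 _)
    inv := conjugateOfNatTrans (T := restriction θ.hom ⋙ restriction τ.hom)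
      (T' := restriction θ.hom ⋙ restriction τ.hom) σ (ρ (τ ≫ θ)) hσ (fun _ => rfl) (𝟙 _)
    hom_inv_id := ProMon.Conjugate.ext <|
      retract_conj_comp (ρ (τ ≫ θ)) σ (ρ (τ ≫ θ)) (𝟙 _) (𝟙 _)
    inv_hom_id := ProMon.Conjugate.ext <|
      (retract_conj_comp σ (ρ (τ ≫ θ)) σ (𝟙 _) (𝟙 _)).trans (hσ (𝟙 _)).symm }

/-- The pseudofunctor sending a categorical pretopos `C` to the endomorphism monoid of `M C`. -/
def endPseudofunctor : Pseudofunctor PTc.{u}ᵒᵖ ProMon.{u} where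
  obj C := endProMon (M C.unop) (hM C.unop)
  map θ := endMap M hM ρ θ.unop
  map₂ α := endMap₂ M hM ρ α.unop2
  map₂_id θ := ProMon.Conjugate.ext <|
    endMap₂_val M hM ρ (𝟙 θ.unop) (𝟙 _)
      (congrArg (fun t => NatTrans.app t (M _)) (restrictionMap_id θ.unop.hom))
  map₂_comp {_ _ θ θ' θ''} α β := ProMon.Conjugate.ext <|
    (endMap₂_val M hM ρ (α.unop2 ≫ β.unop2) _
      (congrArg (fun t => NatTrans.app t (M _))
        (restrictionMap_comp α.unop2.hom β.unop2.hom))).trans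
      (retract_conj_comp (ρ θ.unop) (ρ θ'.unop) (ρ θ''.unop) _ _).symm
  mapId C := endMapId M hM ρ C.unop
  mapComp θ τ := endMapComp M hM ρ τ.unop θ.unop
  map₂_whisker_left θ τ τ' η := ProMon.Conjugate.ext <|
    retract_whiskerLeft (Θ := restriction θ.unop.hom) (T := restriction τ.unop.hom)
      (T' := restriction τ'.unop.hom) (ρ θ.unop) (ρ τ.unop) (ρ τ'.unop)
      (ρ (τ.unop ≫ θ.unop)) (ρ (τ'.unop ≫ θ.unop)) (restrictionMap η.unop2.hom)
  map₂_whisker_right {_ _ _ θ θ'} η τ := ProMon.Conjugate.ext <|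
    retract_whiskerRight (Θ := restriction θ.unop.hom) (Θ' := restriction θ'.unop.hom)
      (T := restriction τ.unop.hom) (ρ θ.unop) (ρ θ'.unop) (ρ τ.unop)
      (ρ (τ.unop ≫ θ.unop)) (ρ (τ.unop ≫ θ'.unop)) (restrictionMap η.unop2.hom)
  map₂_associator θ τ υ := ProMon.Conjugate.ext <|
    -- Reversing 1-cells turns the associator into an inverse associator, and below it exchanges the
    -- two unitors.
    (endMap₂_val M hM ρ (Bicategory.associator υ.unop τ.unop θ.unop).inv (𝟙 _)
      (congrArg (fun t => NatTrans.app t (M _))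
        (restrictionMap_id ((υ.unop ≫ τ.unop ≫ θ.unop).hom)))).trans <|
    retract_associator (Θ := restriction θ.unop.hom) (T := restriction τ.unop.hom)
      (U := restriction υ.unop.hom) (ρ θ.unop) (ρ τ.unop) (ρ υ.unop)
      (ρ (τ.unop ≫ θ.unop)) (ρ (υ.unop ≫ τ.unop)) (ρ (υ.unop ≫ τ.unop ≫ θ.unop))
      (ρ ((υ.unop ≫ τ.unop) ≫ θ.unop))
  map₂_left_unitor {C _} θ := ProMon.Conjugate.ext <|
    (endMap₂_val M hM ρ (Bicategory.rightUnitor θ.unop).hom (𝟙 _)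
      (congrArg (fun t => NatTrans.app t (M _)) (restrictionMap_id θ.unop.hom))).trans <|
    retract_leftUnitor (Θ := restriction θ.unop.hom) (ρ (𝟙 C.unop)) (ρ θ.unop)
      (ρ (θ.unop ≫ 𝟙 C.unop))
  map₂_right_unitor {_ D} θ := ProMon.Conjugate.ext <|
    (endMap₂_val M hM ρ (Bicategory.leftUnitor θ.unop).hom (𝟙 _)
      (congrArg (fun t => NatTrans.app t (M _)) (restrictionMap_id θ.unop.hom))).trans <|
    retract_rightUnitor (Θ := restriction θ.unop.hom) (ρ (𝟙 D.unop)) (ρ θ.unop)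
      (ρ (𝟙 D.unop ≫ θ.unop))

end EndPseudofunctor
end PretoposDuality

theorem mainTheorem5 (star : ∀ C : PTc.{u}, CanonicalModel (CatPretopos.toPretopos C)) :
    ∃ hprof : ∀ C : PTc.{u}, IsProfiniteMonoid (End (star C).model),
      ∀ ρ : ∀ {D C : PTc.{u}} (θ : D ⟶ C), Retract (θ.hom.comp (star C).model) (star D).model,
        ∃ (F : Pseudofunctor PTc.{u}ᵒᵖ ProMon.{u})
          (hobj : ∀ C : PTc.{u}, endProMon (star C).model (hprof C) = F.obj (op C)),
          (∀ {D C : PTc.{u}} (θ : D ⟶ C) (f : End (star C).model),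
            (F.map θ.op).toFun (ProMon.cast (hobj C) f) =
              ProMon.cast (hobj D) (transportEnd (ρ θ) f)) ∧
          (∀ {D C : PTc.{u}} {θ θ' : D ⟶ C} (α : θ ⟶ θ'),
            (F.map₂ (Bicategory.Opposite.op2 α)).val =
              ProMon.cast (hobj D) (transportConj (ρ θ) (ρ θ') α.hom)) := by
  have hprof (C : PTc.{u}) : IsProfiniteMonoid (End (star C).model) :=
    isProfiniteMonoid_end (star C).isCanonical.finite
  -- Objects agree definitionally, so the casts vanish and both formulas hold by `rfl`.
  exact ⟨hprof, fun ρ => ⟨endPseudofunctor (fun C => (star C).model) hprof ρ, fun _ => rfl,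
    fun _ _ => rfl, fun _ => rfl⟩⟩
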